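/- Write $X=\mathbb{R}^2/\mathbb{Z}^2$ with projection $\pi:\mathbb{R}^2\to X$, and let $2^X$ be the space of nonempty compact subsets of $X$ with the Hausdorff (equivalently, Vietoris) topology. A continuous map $f:X\to X$ induces $f_*:2^X\to 2^X$, $f_*(A)=f(A)$. A point $x$ is a transitive point of a map if its omega limit set (the set of limit points of its forward orbit sequence) is the whole space. A Cantor set is a nonempty, perfect, compact, zero-dimensional metrizable space. A Kronecker set for $f$ is a Cantor set $L\subset X$ such that $\{f^n|_L : n\in\mathbb{N}\}$ is dense in the space $\mathcal{C}(L,X)$ of continuous maps with the topology of uniform convergence. **Theorem 4.3.** Let $A$ be a $2\times 2$ integer matrix with $\det A=\pm1$ and no complex eigenvalue of modulus $1$, for example $A=\begin{pmatrix}3&1\\5&2\end{pmatrix}$, and let $t:X\to X$ be the hyperbolic toral automorphism induced by $A$. Then there exist a transitive point $C\in 2^X$ of $t_*$ and a Cantor set $L\subset X$ such that $C$ is homeomorphic to $L\times[0,1]$, and every connected component of $C$ is homeomorphic to $[0,1]$. Moreover $C$ and $L$ can be chosen so that $C$ is obtained by thickening a Kronecker set along stable lines: $L$ is a Kronecker set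 for $t$, and there are a unit vector $v\in\mathbb{R}^2$, a real $\mu$ with $|\mu|<1$ and $Av=\mu v$, and $M>0$, such that $(a,s)\mapsto a+\pi(sv)$ is a homeomorphism from $L\times[-M,M]$ onto $C$. -/

import Mathlib

open Set Filter Topology TopologicalSpace

/-- A point `x` is a transitive point of `f` when its omega limit set (the set of limit points of
the orbit sequence `f^n x`) is the whole space. -/
def IsTransitivePoint {X : Type*} [TopologicalSpace X] (f : X → X) (x : X) : Prop :=
  omegaLimit atTop (fun n : ℕ => f^[n]) {x} = univ

/-- The induced map `A ↦ f(A)` on the space `2^X` of nonempty compact subsets of `X`. -/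
def inducedMap {X : Type*} [TopologicalSpace X] (f : C(X, X)) :
    NonemptyCompacts X → NonemptyCompacts X :=
  NonemptyCompacts.map f f.continuous

/-- A Cantor set in a metrizable space: nonempty, compact, without isolated points, and
zero-dimensional (for compact Hausdorff sets this means totally disconnected). -/
def IsCantorSet {X : Type*} [TopologicalSpace X] (L : Set X) : Prop :=
  L.Nonempty ∧ IsCompact L ∧ Preperfect L ∧ IsTotallyDisconnected L

/-- The restriction of the `n`-th iterate of `f` to a subset `L`, as an element of `C(L, X)`. -/
def iterateRestrict {X : Type*} [TopologicalSpace X] (f : C(X, X)) (L : Set X) (n : ℕ) :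
    C(L, X) :=
  ⟨fun x => f^[n] (x : X), (f.continuous.iterate n).comp continuous_subtype_val⟩

/-- A Kronecker set for `(X, f)`: a Cantor set `L` in `X` such that the restrictions to `L` of the
iterates of `f` are dense in `C(L, X)`. The topology of `C(L, X)` is the compact-open one, which is
that of uniform convergence since `L` is compact. -/
def IsKroneckerSet {X : Type*} [TopologicalSpace X] (f : C(X, X)) (L : Set X) : Prop :=
  IsCantorSet L ∧ Dense (range (iterateRestrict f L))

/-- The canonical projection from `ℝ²` to `ℝ² / ℤ²`. -/
def torusProj (x : EuclideanSpace ℝ (Fin 2)) : UnitAddTorus (Fin 2) :=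
  fun i => ((x i : ℝ) : UnitAddCircle)

/-- The map of `ℝ² / ℤ²` induced by an integer matrix. -/
def toralMap (A : Matrix (Fin 2) (Fin 2) ℤ) : C(UnitAddTorus (Fin 2), UnitAddTorus (Fin 2)) where
  toFun x i := ∑ j, A i j • x j
  continuous_toFun := by fun_prop

/-- The linear map of `ℝ²` given by an integer matrix. -/
def planeMap (A : Matrix (Fin 2) (Fin 2) ℤ) (x : EuclideanSpace ℝ (Fin 2)) :
    EuclideanSpace ℝ (Fin 2) :=
  WithLp.toLp 2 ((A.map (Int.cast : ℤ → ℝ)).mulVec x.ofLp)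

/-- The torus map is the one induced by the linear map. -/
theorem toralMap_torusProj (A : Matrix (Fin 2) (Fin 2) ℤ) (x : EuclideanSpace ℝ (Fin 2)) :
    toralMap A (torusProj x) = torusProj (planeMap A x) := by
  funext i
  simp only [toralMap, torusProj, planeMap, Matrix.mulVec, dotProduct, Fin.sum_univ_two,
    ContinuousMap.coe_mk, Matrix.map_apply, ← AddCircle.coe_zsmul, zsmul_eq_mul, AddCircle.coe_add]

/-- An integer matrix that induces a hyperbolic automorphism of the torus: it is
invertible over `ℤ` and has no complex eigenvalue of modulus one. -/
def IsHyperbolicToral (A : Matrix (Fin 2) (Fin 2) ℤ) : Prop :=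
  IsUnit A.det ∧ ∀ z ∈ spectrum ℂ (A.map (Int.cast : ℤ → ℂ)), ‖z‖ ≠ 1

/-- The standard example of a hyperbolic matrix considered here. -/
theorem isHyperbolicToral_example : IsHyperbolicToral !![3, 1; 5, 2] := by
  refine ⟨by simp [Matrix.det_fin_two], fun z hz h1 => ?_⟩
  rw [Matrix.mem_spectrum_iff_isRoot_charpoly, Polynomial.IsRoot.def,
    Matrix.eval_charpoly] at hz
  simp [Matrix.det_fin_two, Matrix.scalar_apply] at hz
  have h : 5 * z = z ^ 2 + 1 := by linear_combination -hz
  have h5 : ‖5 * z‖ = 5 := by simp [h1]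
  have h2 : ‖z ^ 2 + 1‖ ≤ 2 := by
    refine (norm_add_le _ _).trans ?_
    rw [norm_pow, h1]; norm_num
  rw [h] at h5
  linarith

/-! The expanding eigenline of `A` has irrational slope, so its image in the torus is dense, and
multiplying the line by the expanding eigenvalue spreads every segment of it over the whole torus.
A map `h` from the Cantor space `K` to this line is approximately locally constant, so finitely
many segments can be spread independently; by Baire category a generic small `h` therefore has
iterates `t^n ∘ h` that accumulate at every element of `C(K, X)`. Its image `L` is a Kronecker set.

Thickening `L` along the contracting eigenline does not affect the asymptotics: `t` contracts the
added segments, so `t^n C` and `t^n L` become indistinguishable. Since every nonempty compact subset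
of `X` is a continuous image of `K`, the sets `t^n C` accumulate at all of `2^X`. -/

open scoped ComplexConjugate

/-! ### Eigenvalues of integer matrices -/

theorem irrational_of_mem_spectrum {n : Type*} [Fintype n] [DecidableEq n] {A : Matrix n n ℤ}
    {a : ℝ} (ha : a ∈ spectrum ℝ (A.map (Int.cast : ℤ → ℝ))) (ha0 : a ≠ 0) (ha1 : |a| < 1) :
    Irrational a := by
  have hint : IsIntegral ℤ a := by
    refine ⟨A.charpoly, A.charpoly_monic, ?_⟩
    rw [Polynomial.eval₂_eq_eval_map, ← Matrix.charpoly_map]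
    exact Matrix.mem_spectrum_iff_isRoot_charpoly.1 ha
  rintro ⟨q, hq⟩
  obtain ⟨m, rfl⟩ := hint.exists_int_iff_exists_rat.1 ⟨q, hq.symm⟩
  rw [← Int.cast_abs, ← Int.cast_one, Int.cast_lt, Int.abs_lt_one_iff] at ha1
  exact ha0 (by simp [ha1])

theorem mem_spectrum_map_intCast_iff {K : Type*} [Field K] {A : Matrix (Fin 2) (Fin 2) ℤ} {z : K} :
    z ∈ spectrum K (A.map (Int.cast : ℤ → K)) ↔ z ^ 2 - A.trace * z + A.det = 0 := by
  simp [Matrix.mem_spectrum_iff_isRoot_charpoly, Matrix.charpoly_fin_two, Matrix.trace_fin_two,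
    Matrix.det_fin_two]

theorem mul_trace_sub_eq_det {K : Type*} [Field K] {A : Matrix (Fin 2) (Fin 2) ℤ} {z : K}
    (hz : z ∈ spectrum K (A.map (Int.cast : ℤ → K))) : z * (A.trace - z) = A.det := by
  linear_combination -mem_spectrum_map_intCast_iff.1 hz

theorem trace_sub_mem_spectrum {K : Type*} [Field K] {A : Matrix (Fin 2) (Fin 2) ℤ} {z : K}
    (hz : z ∈ spectrum K (A.map (Int.cast : ℤ → K))) :
    A.trace - z ∈ spectrum K (A.map (Int.cast : ℤ → K)) := by
  rw [mem_spectrum_map_intCast_iff] at hz ⊢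
  linear_combination hz

theorem IsHyperbolicToral.exists_mem_spectrum_norm_lt_one {A : Matrix (Fin 2) (Fin 2) ℤ}
    (hA : IsHyperbolicToral A) : ∃ z ∈ spectrum ℂ (A.map (Int.cast : ℤ → ℂ)), ‖z‖ < 1 := by
  obtain ⟨z, hz⟩ := spectrum.nonempty_of_isAlgClosed_of_finiteDimensional ℂ
    (A.map (Int.cast : ℤ → ℂ))
  have hmul : ‖z‖ * ‖A.trace - z‖ = 1 := by
    rw [← norm_mul, mul_trace_sub_eq_det hz]
    rcases Int.isUnit_iff.1 hA.1 with h | h <;> simp [h]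
  rcases lt_or_gt_of_ne (hA.2 z hz) with h | h
  · exact ⟨z, hz, h⟩
  · exact ⟨_, trace_sub_mem_spectrum hz, by nlinarith [norm_nonneg (A.trace - z)]⟩

theorem exists_real_mem_spectrum_of_norm_lt_one {A : Matrix (Fin 2) (Fin 2) ℤ} (hdet : A.det ≠ 0)
    {z : ℂ} (hz : z ∈ spectrum ℂ (A.map (Int.cast : ℤ → ℂ))) (hz1 : ‖z‖ < 1) :
    ∃ a ∈ spectrum ℝ (A.map (Int.cast : ℤ → ℝ)), |a| < 1 := by
  have hroot := mem_spectrum_map_intCast_iff.1 hz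
  have hconj : conj z ^ 2 - A.trace * conj z + A.det = 0 := by
    simpa using congrArg conj hroot
  have hreal : conj z = z := by
    by_contra hne
    -- otherwise `z` and its conjugate are the two roots, and `det A = |z|² < 1`
    have hsum : z + conj z = A.trace :=
      mul_left_cancel₀ (sub_ne_zero.2 hne) (by linear_combination hconj - hroot)
    have hnorm : ‖z‖ ^ 2 = A.det := by
      refine Complex.ofReal_injective ?_
      rw [Complex.ofReal_pow, ← Complex.mul_conj', Complex.ofReal_intCast,
        ← mul_trace_sub_eq_det hz, ← hsum, add_sub_cancel_left]
    have hlt : |(A.det : ℝ)| < 1 := by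
      rw [← hnorm, abs_of_nonneg (sq_nonneg _)]
      exact pow_lt_one₀ (norm_nonneg z) hz1 two_ne_zero
    exact hdet (Int.abs_lt_one_iff.1 (by exact_mod_cast hlt))
  obtain ⟨a, rfl⟩ := Complex.conj_eq_iff_real.1 hreal
  refine ⟨a, mem_spectrum_map_intCast_iff.2 (Complex.ofReal_injective ?_), by simpa using hz1⟩
  push_cast [-Int.cast_det]
  exact hroot

theorem exists_stable_unstable_eigenvalues {A : Matrix (Fin 2) (Fin 2) ℤ} (hdet : A.det ≠ 0)
    {z : ℂ} (hz : z ∈ spectrum ℂ (A.map (Int.cast : ℤ → ℂ))) (hz1 : ‖z‖ < 1) :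
    ∃ a ∈ spectrum ℝ (A.map (Int.cast : ℤ → ℝ)), ∃ b ∈ spectrum ℝ (A.map (Int.cast : ℤ → ℝ)),
      |a| < 1 ∧ 1 < |b| ∧ Irrational b := by
  obtain ⟨a, ha, ha1⟩ := exists_real_mem_spectrum_of_norm_lt_one hdet hz hz1
  have hab := mul_trace_sub_eq_det ha
  have ha0 : a ≠ 0 := by
    rintro rfl
    exact hdet (by simpa using hab.symm)
  have habs : 1 ≤ |a| * |A.trace - a| := by
    rw [← abs_mul, hab]
    exact_mod_cast Int.one_le_abs hdet
  refine ⟨a, ha, A.trace - a, trace_sub_mem_spectrum ha, ha1, ?_,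
    (irrational_of_mem_spectrum ha ha0 ha1).intCast_sub _⟩
  nlinarith [abs_pos.2 ha0]

/-! ### Eigenlines of the plane -/

theorem exists_norm_eq_one_planeMap_eq_smul {A : Matrix (Fin 2) (Fin 2) ℤ} {a : ℝ}
    (ha : a ∈ spectrum ℝ (A.map (Int.cast : ℤ → ℝ))) :
    ∃ v : EuclideanSpace ℝ (Fin 2), ‖v‖ = 1 ∧ planeMap A v = a • v := by
  rw [← Matrix.spectrum_toLpLin 2] at ha
  obtain ⟨v, hv⟩ := (Module.End.HasEigenvalue.of_mem_spectrum ha).exists_hasEigenvector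
  refine ⟨‖v‖⁻¹ • v, norm_smul_inv_norm hv.2, ?_⟩
  exact Module.End.mem_eigenspace_iff.1 (Submodule.smul_mem _ _ hv.1)

theorem linearIndependent_pair_of_planeMap_eq_smul {A : Matrix (Fin 2) (Fin 2) ℤ}
    {v w : EuclideanSpace ℝ (Fin 2)} {a b : ℝ} (hab : a ≠ b) (hv0 : v ≠ 0) (hw0 : w ≠ 0)
    (hv : planeMap A v = a • v) (hw : planeMap A w = b • w) : LinearIndependent ℝ ![v, w] := by
  refine Module.End.eigenvectors_linearIndependent'
    (Matrix.toLpLin 2 2 (A.map (Int.cast : ℤ → ℝ))) ![a, b] ?_ _ ?_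
  · simpa [Function.Injective, Fin.forall_fin_two] using ⟨hab, hab.symm⟩
  · exact Fin.forall_fin_two.2 ⟨⟨Module.End.mem_eigenspace_iff.2 hv, hv0⟩,
      ⟨Module.End.mem_eigenspace_iff.2 hw, hw0⟩⟩

theorem irrational_slope_of_planeMap_eq_smul {A : Matrix (Fin 2) (Fin 2) ℤ} {b : ℝ}
    (hb : Irrational b) {w : EuclideanSpace ℝ (Fin 2)} (hw0 : w ≠ 0) (hw : planeMap A w = b • w) :
    w 0 ≠ 0 ∧ Irrational (w 1 / w 0) := by
  have h0 : A 0 0 * w 0 + A 0 1 * w 1 = b * w 0 := by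
    simpa [planeMap] using congrFun (congrArg WithLp.ofLp hw) 0
  have h1 : A 1 0 * w 0 + A 1 1 * w 1 = b * w 1 := by
    simpa [planeMap] using congrFun (congrArg WithLp.ofLp hw) 1
  have hw00 : w 0 ≠ 0 := by
    intro hz
    have hw1 : w 1 ≠ 0 := fun hz1 => hw0 (by ext i; fin_cases i <;> simp [hz, hz1])
    rw [hz, mul_zero, zero_add] at h1
    exact hb ⟨A 1 1, by simpa using mul_right_cancel₀ hw1 h1⟩
  refine ⟨hw00, ?_⟩
  rintro ⟨q, hq⟩
  have hw1 : w 1 = q * w 0 := (eq_div_iff hw00).1 hq |>.symm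
  refine hb ⟨A 0 0 + A 0 1 * q, mul_right_cancel₀ hw00 ?_⟩
  rw [← h0, hw1]
  push_cast
  ring

/-! ### Universal sequences of maps -/

/-- Topological mixing for a sequence of maps between possibly different spaces: for nonempty open
`U` and `V`, the image `F n U` meets `V` for all large `n`. -/
def IsMixingSeq {P X : Type*} [TopologicalSpace P] [TopologicalSpace X] (F : ℕ → P → X) : Prop :=
  ∀ ⦃U : Set P⦄ ⦃V : Set X⦄, IsOpen U → U.Nonempty → IsOpen V → V.Nonempty →
    ∀ᶠ n in atTop, (U ∩ F n ⁻¹' V).Nonempty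

theorem IsMixingSeq.dense_forall_mapClusterPt {H Y : Type*} [TopologicalSpace H] [BaireSpace H]
    [TopologicalSpace Y] [SecondCountableTopology Y] {G : ℕ → H → Y} (hG : IsMixingSeq G)
    (hcont : ∀ n, Continuous (G n)) : Dense {h | ∀ y, MapClusterPt y atTop (G · h)} := by
  let visits (i : countableBasis Y × ℕ) : Set H := ⋃ n ≥ i.2, G n ⁻¹' i.1
  have hopen i : IsOpen (visits i) := isOpen_biUnion fun n _ =>
    (isOpen_of_mem_countableBasis i.1.2).preimage (hcont n)
  have hdense i : Dense (visits i) := dense_iff_inter_open.2 fun U hU hUne => by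
    obtain ⟨n, ⟨h, hhU, hhV⟩, hn⟩ := ((hG hU hUne (isOpen_of_mem_countableBasis i.1.2)
      (nonempty_of_mem_countableBasis i.1.2)).and (eventually_ge_atTop i.2)).exists
    exact ⟨h, hhU, mem_biUnion hn hhV⟩
  refine (dense_iInter_of_isOpen hopen hdense).mono fun h hh y => ?_
  refine (isBasis_countableBasis Y).nhds_hasBasis.mapClusterPt_iff_frequently.2 fun V hV =>
    frequently_atTop.2 fun N => ?_
  obtain ⟨n, hn, hnV⟩ := mem_iUnion₂.1 (mem_iInter.1 hh (⟨V, hV.1⟩, N))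
  exact ⟨n, hn, hnV⟩

theorem exists_finite_approximation {K X : Type*} [TopologicalSpace K] [CompactSpace K] [T2Space K]
    [TotallyDisconnectedSpace K] [PseudoMetricSpace X] (f : C(K, X)) {ε : ℝ} (hε : 0 < ε) :
    ∃ (k : ℕ) (p : C(K, Fin k)) (q : Fin k → X), ∀ x, dist (f x) (q (p x)) < ε := by
  obtain ⟨k, p, q, hp, hpq⟩ := f.exists_finite_approximation_of_mem_nhds_diagonal
    (S := {z | dist z.1 z.2 < ε}) (mem_nhdsSet_iff_forall.2 <| by
      rintro ⟨x, y⟩ (rfl : x = y)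
      exact (isOpen_lt continuous_dist continuous_const).mem_nhds (by simpa using hε))
  exact ⟨k, ⟨p, hp⟩, q, hpq⟩

theorem IsMixingSeq.postcomp {K P X : Type*} [TopologicalSpace K] [CompactSpace K] [T2Space K]
    [TotallyDisconnectedSpace K] [PseudoMetricSpace P] [PseudoMetricSpace X] {F : ℕ → C(P, X)}
    (hF : IsMixingSeq fun n => F n) : IsMixingSeq fun n (h : C(K, P)) => (F n).comp h := by
  rintro U V hU ⟨h₀, hh₀⟩ hV ⟨g₀, hg₀⟩
  obtain ⟨ε, hε, hεU⟩ := Metric.isOpen_iff.1 hU h₀ hh₀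
  obtain ⟨δ, hδ, hδV⟩ := Metric.isOpen_iff.1 hV g₀ hg₀
  obtain ⟨k, p, q, hpq⟩ := exists_finite_approximation (h₀.prodMk g₀)
    (ε := min (ε / 2) (δ / 2)) (by positivity)
  have hvisit : ∀ᶠ n in atTop, ∀ i : Fin k,
      (Metric.ball (q i).1 (ε / 2) ∩ F n ⁻¹' Metric.ball (q i).2 (δ / 2)).Nonempty :=
    eventually_all.2 fun i => hF Metric.isOpen_ball (Metric.nonempty_ball.2 (half_pos hε))
      Metric.isOpen_ball (Metric.nonempty_ball.2 (half_pos hδ))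
  filter_upwards [hvisit] with n hn
  choose c hcU hcV using hn
  refine ⟨(⟨c, continuous_of_discreteTopology⟩ : C(Fin k, P)).comp p,
    hεU ((ContinuousMap.dist_lt_iff hε).2 fun x => ?_),
    hδV ((ContinuousMap.dist_lt_iff hδ).2 fun x => ?_)⟩
  · have hx : dist (h₀ x) (q (p x)).1 < ε / 2 :=
      (le_max_left _ _).trans_lt ((hpq x).trans_le (min_le_left _ _))
    exact (dist_triangle_right _ _ (q (p x)).1).trans_lt
      ((add_lt_add (hcU (p x)) hx).trans_eq (add_halves ε))
  · have hx : dist (g₀ x) (q (p x)).2 < δ / 2 :=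
      (le_max_right _ _).trans_lt ((hpq x).trans_le (min_le_right _ _))
    exact (dist_triangle_right _ _ (q (p x)).2).trans_lt
      ((add_lt_add (hcV (p x)) hx).trans_eq (add_halves δ))

theorem injective_of_forall_mapClusterPt {K P X : Type*} [TopologicalSpace K]
    [TotallySeparatedSpace K] [TopologicalSpace P] [TopologicalSpace X] [T2Space X] [Nontrivial X]
    {F : ℕ → C(P, X)} {h : C(K, P)}
    (hF : ∀ g : C(K, X), MapClusterPt g atTop fun n => (F n).comp h) : Function.Injective h := by
  classical
  intro x y hxy
  by_contra hne
  obtain ⟨U, hU, hxU, hyU⟩ := exists_isClopen_of_totally_separated hne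
  obtain ⟨a, b, hab⟩ := exists_pair_ne X
  let g : C(K, X) := ⟨U.piecewise (fun _ => a) fun _ => b,
    continuous_const.piecewise (by simp [hU.frontier_eq]) continuous_const⟩
  have hclosed : IsClosed {k : C(K, X) | k x = k y} :=
    isClosed_eq (by fun_prop) (by fun_prop)
  have hg : g x = g y :=
    hclosed.mem_of_mapClusterPt (hF g) (.of_forall fun n => congrArg (F n) hxy)
  exact hab (by simpa [g, hxU, show y ∉ U from hyU] using hg)

theorem exists_norm_le_dist_lt_of_denseRange {E X : Type*} [SeminormedAddCommGroup E]
    [PseudoMetricSpace X] [CompactSpace X] {φ : E → X} (hφ : DenseRange φ) {δ : ℝ} (hδ : 0 < δ) :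
    ∃ R, ∀ y, ∃ s, ‖s‖ ≤ R ∧ dist y (φ s) < δ := by
  obtain ⟨R, hR⟩ := isCompact_univ.elim_directed_cover
    (fun R : ℝ => ⋃ s ∈ {s : E | ‖s‖ ≤ R}, Metric.ball (φ s) δ)
    (fun R => isOpen_biUnion fun _ _ => Metric.isOpen_ball)
    (fun y _ => by
      obtain ⟨s, hs⟩ := hφ.exists_dist_lt y hδ
      exact mem_iUnion.2 ⟨‖s‖, mem_biUnion (mem_ofPred.2 le_rfl) hs⟩)
    (Monotone.directed_le fun R R' hRR' =>
      biUnion_subset_biUnion_left fun s (hs : ‖s‖ ≤ R) => hs.trans hRR')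
  refine ⟨R, fun y => ?_⟩
  simpa using hR (mem_univ y)

/- Given a centre `c₀`, add to it a vector of size `≤ R / ‖b‖ ^ n` which, expanded by `b ^ n`,
corrects the image of `c₀`. -/
theorem isMixingSeq_pow_smul {𝕜 E X : Type*} [NormedField 𝕜] [SeminormedAddCommGroup E]
    [NormedSpace 𝕜 E] [SeminormedAddCommGroup X] [CompactSpace X] {φ : E →+ X}
    (hφ : DenseRange φ) {b : 𝕜} (hb : 1 < ‖b‖) : IsMixingSeq fun n c => φ (b ^ n • c) := by
  rintro U V hU ⟨c₀, hc₀⟩ hV ⟨y₀, hy₀⟩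
  obtain ⟨ε, hε, hεU⟩ := Metric.isOpen_iff.1 hU c₀ hc₀
  obtain ⟨δ, hδ, hδV⟩ := Metric.isOpen_iff.1 hV y₀ hy₀
  obtain ⟨R, hR⟩ := exists_norm_le_dist_lt_of_denseRange hφ hδ
  have hlarge : ∀ᶠ n in atTop, R / ε < ‖b‖ ^ n :=
    (tendsto_pow_atTop_atTop_of_one_lt hb).eventually_gt_atTop _
  filter_upwards [hlarge] with n hn
  obtain ⟨s, hsR, hs⟩ := hR (y₀ - φ (b ^ n • c₀))
  have hb0 : b ^ n ≠ 0 := pow_ne_zero _ (norm_pos_iff.1 (one_pos.trans hb))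
  refine ⟨c₀ + (b ^ n)⁻¹ • s, hεU ?_, hδV ?_⟩
  · rw [mem_ball_iff_norm, add_sub_cancel_left, norm_smul, norm_inv, norm_pow,
      inv_mul_lt_iff₀ (by positivity)]
    exact hsR.trans_lt ((div_lt_iff₀ hε).1 hn)
  · change φ (b ^ n • (c₀ + (b ^ n)⁻¹ • s)) ∈ Metric.ball y₀ δ
    rwa [Metric.mem_ball', smul_add, smul_inv_smul₀ hb0, map_add, dist_eq_norm, ← sub_sub,
      ← dist_eq_norm]

/-! ### Cantor sets and Kronecker sets -/

section Kronecker

theorem perfectSpace_pi {ι : Type*} [Infinite ι] {X : ι → Type*} [∀ i, TopologicalSpace (X i)]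
    [∀ i, Nontrivial (X i)] : PerfectSpace (∀ i, X i) := by
  classical
  refine perfectSpace_iff_forall_not_isolated.2 fun x => ?_
  choose y hy using fun i => exists_ne (x i)
  have hlim : Tendsto (fun i => Function.update x i (y i)) cofinite (𝓝[≠] x) := by
    refine tendsto_nhdsWithin_iff.2 ⟨tendsto_pi_nhds.2 fun j => ?_, .of_forall fun i => ?_⟩
    · refine tendsto_const_nhds.congr' ?_
      filter_upwards [(finite_singleton j).compl_mem_cofinite] with i hi
      exact (Function.update_of_ne (Ne.symm hi) _ _).symm
    · simpa using hy i
  exact hlim.neBot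

theorem isCantorSet_range {K X : Type*} [TopologicalSpace K] [CompactSpace K] [Nonempty K]
    [PerfectSpace K] [TotallyDisconnectedSpace K] [TopologicalSpace X] {e : K → X}
    (he : IsEmbedding e) : IsCantorSet (range e) := by
  refine ⟨range_nonempty e, isCompact_range he.continuous, ?_, ?_⟩
  · rintro _ ⟨x, rfl⟩
    simpa using (PerfectSpace.univ_preperfect x (mem_univ x)).map
      he.continuous.continuousAt he.injective
  · rw [← image_univ]
    exact he.isTotallyDisconnected_image.2 (isTotallyDisconnected_of_totallyDisconnectedSpace _)

variable {K X : Type*} [TopologicalSpace K] [TopologicalSpace X]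

/-- The parametrized set `e : K → X` carried along the orbit of `f`, that is `f^n ∘ e`. -/
def iterateAlong (f : C(X, X)) (e : C(K, X)) (n : ℕ) : C(K, X) :=
  ⟨f^[n] ∘ e, (f.continuous.iterate n).comp e.continuous⟩

/-- A parametrized version of Kronecker sets, in which `e` need not be injective: every continuous
map from the parameter space is approximated by `f^n ∘ e` for infinitely many `n`. -/
def IsKroneckerFamily (f : C(X, X)) (e : C(K, X)) : Prop :=
  ∀ g : C(K, X), MapClusterPt g atTop (iterateAlong f e)

theorem IsKroneckerFamily.denseRange {f : C(X, X)} {e : C(K, X)} (h : IsKroneckerFamily f e) :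
    DenseRange (iterateAlong f e) := fun g =>
  isClosed_closure.mem_of_mapClusterPt (h g)
    (.of_forall fun n => subset_closure (mem_range_self n))

theorem IsKroneckerFamily.isKroneckerSet_range [CompactSpace K] [Nonempty K] [PerfectSpace K]
    [TotallyDisconnectedSpace K] {f : C(X, X)} {e : C(K, X)} (h : IsKroneckerFamily f e)
    (he : IsEmbedding e) : IsKroneckerSet f (range e) := by
  refine ⟨isCantorSet_range he, ?_⟩
  let ψ : C(K, X) → C(range e, X) := fun g => g.comp he.toHomeomorph.symm
  have hψ : Function.Surjective ψ := fun g =>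
    ⟨g.comp he.toHomeomorph, ContinuousMap.ext fun x => by simp [ψ]⟩
  have hrange : iterateRestrict f (range e) = ψ ∘ iterateAlong f e := by
    funext n
    ext ⟨_, x, rfl⟩ : 1
    simp [iterateRestrict, iterateAlong, ψ, he.toHomeomorph_symm_apply]
  rw [hrange]
  exact hψ.denseRange.comp h.denseRange (ContinuousMap.continuous_precomp _)

end Kronecker

/-! ### Transitivity of the induced map -/

/-- The range of a continuous map, as a point of the hyperspace of nonempty compact sets. -/
def rangeCompacts {K X : Type*} [TopologicalSpace K] [CompactSpace K] [Nonempty K]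
    [TopologicalSpace X] (g : C(K, X)) : NonemptyCompacts X where
  carrier := range g
  isCompact' := isCompact_range g.continuous
  nonempty' := range_nonempty g

theorem continuous_rangeCompacts {K X : Type*} [TopologicalSpace K] [CompactSpace K]
    [LocallyCompactSpace K] [Nonempty K] [TopologicalSpace X] :
    Continuous (rangeCompacts : C(K, X) → NonemptyCompacts X) := by
  have hmap : (rangeCompacts : C(K, X) → NonemptyCompacts X) =
      fun g : C(K, X) => (⊤ : NonemptyCompacts K).map g g.continuous := by
    ext g : 2
    simp [rangeCompacts]
  rw [hmap]
  fun_prop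

theorem rangeCompacts_comp {K K' X : Type*} [TopologicalSpace K] [CompactSpace K] [Nonempty K]
    [TopologicalSpace K'] [CompactSpace K'] [Nonempty K'] [TopologicalSpace X] (g : C(K, X))
    {p : C(K', K)} (hp : Function.Surjective p) :
    rangeCompacts (g.comp p) = rangeCompacts g :=
  NonemptyCompacts.ext (hp.range_comp g)

theorem iterate_inducedMap_rangeCompacts {K X : Type*} [TopologicalSpace K] [CompactSpace K]
    [Nonempty K] [TopologicalSpace X] (f : C(X, X)) (g : C(K, X)) (n : ℕ) :
    (inducedMap f)^[n] (rangeCompacts g) = rangeCompacts (iterateAlong f g n) := by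
  induction n with
  | zero => rfl
  | succ n ih =>
    rw [Function.iterate_succ_apply', ih]
    ext1
    rw [inducedMap, NonemptyCompacts.coe_map]
    simp only [rangeCompacts, iterateAlong, Function.iterate_succ', Function.comp_assoc]
    exact (range_comp _ _).symm

theorem exists_rangeCompacts_eq {X : Type*} [MetricSpace X] (Y : NonemptyCompacts X) :
    ∃ g : C(ℕ → Bool, X), rangeCompacts g = Y := by
  have : Nonempty Y := Y.nonempty.to_subtype
  have : CompactSpace Y := isCompact_iff_compactSpace.1 Y.isCompact
  obtain ⟨g, hg, hsurj⟩ := exists_nat_bool_continuous_surjective_of_compact Y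
  refine ⟨⟨_, continuous_subtype_val.comp hg⟩, NonemptyCompacts.ext ?_⟩
  exact (hsurj.range_comp _).trans Subtype.range_coe

theorem mapClusterPt_congr_dist {ι X : Type*} [PseudoMetricSpace X] {l : Filter ι} {u v : ι → X}
    {x : X} (huv : Tendsto (fun i => dist (u i) (v i)) l (𝓝 0)) :
    MapClusterPt x l u ↔ MapClusterPt x l v := by
  simp only [mapClusterPt_iff_ultrafilter]
  exact exists_congr fun _ => and_congr_right fun hle => tendsto_iff_of_dist (huv.mono_left hle)

theorem IsKroneckerFamily.isTransitivePoint_rangeCompacts {K X : Type*} [TopologicalSpace K]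
    [CompactSpace K] [LocallyCompactSpace K] [Nonempty K] [MetricSpace X] {f : C(X, X)}
    {e : C(ℕ → Bool, X)} (he : IsKroneckerFamily f e) {p : C(K, ℕ → Bool)}
    (hp : Function.Surjective p) {g : C(K, X)}
    (hg : Tendsto (fun n => dist (iterateAlong f g n) (iterateAlong f (e.comp p) n)) atTop (𝓝 0)) :
    IsTransitivePoint (inducedMap f) (rangeCompacts g) := by
  refine eq_univ_of_forall fun Y => ?_
  obtain ⟨k, rfl⟩ := exists_rangeCompacts_eq Y
  rw [mem_omegaLimit_singleton_iff_mapClusterPt]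
  simp only [iterate_inducedMap_rangeCompacts]
  rw [← rangeCompacts_comp k hp]
  refine MapClusterPt.continuousAt_comp continuous_rangeCompacts.continuousAt
    ((mapClusterPt_congr_dist hg).2 ?_)
  exact (he k).continuousAt_comp (ContinuousMap.continuous_precomp p).continuousAt

/-! ### Products with an interval -/

theorem nonempty_homeomorph_connectedComponentIn {X L I : Type*} [TopologicalSpace X]
    [TopologicalSpace L] [TopologicalSpace I] [TotallyDisconnectedSpace L] [ConnectedSpace I]
    {C : Set X} (ψ : C ≃ₜ L × I) {x : X} (hx : x ∈ C) :
    Nonempty (connectedComponentIn C x ≃ₜ I) := by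
  let fiber : I → C := fun s => ψ.symm ((ψ ⟨x, hx⟩).1, s)
  have hfiber : IsEmbedding fiber := ψ.symm.isEmbedding.comp (isEmbedding_prodMkRight _)
  have hcomponent : connectedComponent ⟨x, hx⟩ = range fiber := by
    refine Subset.antisymm (fun q hq => ?_) ?_
    · have himage := (continuous_fst.comp ψ.continuous).image_connectedComponent_eq_singleton
        ⟨x, hx⟩
      have hfst : (ψ q).1 = (ψ ⟨x, hx⟩).1 := himage.subset (mem_image_of_mem _ hq)
      exact ⟨(ψ q).2, by simp [fiber, ← hfst]⟩
    · exact (isPreconnected_range hfiber.continuous).subset_connectedComponent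
        ⟨(ψ ⟨x, hx⟩).2, by simp [fiber]⟩
  have hrange : connectedComponentIn C x = range (Subtype.val ∘ fiber) := by
    rw [connectedComponentIn_eq_image hx, hcomponent, range_comp]
  exact ⟨(Homeomorph.setCongr hrange).trans
    (IsEmbedding.subtypeVal.comp hfiber).toHomeomorph.symm⟩

/-- The homeomorphism from `range e × J` to the range of an embedding `Φ` of `K × J` obtained by
reading the first coordinate through the embedding `e`. -/
noncomputable def rangeProdHomeomorph {K J X Y : Type*} [TopologicalSpace K] [TopologicalSpace J]
    [TopologicalSpace X] [TopologicalSpace Y] {e : K → X} {Φ : K × J → Y} (he : IsEmbedding e)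
    (hΦ : IsEmbedding Φ) : range e × J ≃ₜ range Φ :=
  (he.toHomeomorph.symm.prodCongr (Homeomorph.refl J)).trans hΦ.toHomeomorph

theorem rangeProdHomeomorph_apply {K J X Y : Type*} [TopologicalSpace K] [TopologicalSpace J]
    [TopologicalSpace X] [TopologicalSpace Y] {e : K → X} {Φ : K × J → Y} (he : IsEmbedding e)
    (hΦ : IsEmbedding Φ) (x : K) (s : J) :
    (rangeProdHomeomorph he hΦ (⟨e x, mem_range_self x⟩, s) : Y) = Φ (x, s) := by
  have hx : he.toHomeomorph.symm ⟨e x, mem_range_self x⟩ = x :=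
    he.toHomeomorph.symm_apply_eq.2 rfl
  simp [rangeProdHomeomorph, hx]

/-! ### Lines in the torus -/

theorem torusProj_add (x y : EuclideanSpace ℝ (Fin 2)) :
    torusProj (x + y) = torusProj x + torusProj y := by
  ext i
  simp [torusProj]

theorem norm_torusProj_le (x : EuclideanSpace ℝ (Fin 2)) : ‖torusProj x‖ ≤ ‖x‖ :=
  (pi_norm_le_iff_of_nonneg (norm_nonneg x)).2 fun i =>
    QuotientAddGroup.norm_mk_le_norm.trans (PiLp.norm_apply_le x i)

theorem injOn_torusProj_ball : InjOn torusProj (Metric.ball 0 (1 / 2)) := by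
  intro x hx y hy hxy
  ext i
  have hcoe : ((x i - y i : ℝ) : UnitAddCircle) = 0 := by
    rw [AddCircle.coe_sub, sub_eq_zero]
    exact congrFun hxy i
  obtain ⟨n, hn⟩ := (AddCircle.coe_eq_zero_iff (1 : ℝ)).1 hcoe
  rw [zsmul_one] at hn
  have hlt : |(n : ℝ)| < 1 := by
    rw [mem_ball_zero_iff] at hx hy
    rw [hn]
    calc |x i - y i| ≤ ‖x - y‖ := PiLp.norm_apply_le (x - y) i
      _ ≤ ‖x‖ + ‖y‖ := norm_sub_le x y
      _ < 1 := by linarith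
  have hn0 : n = 0 := Int.abs_lt_one_iff.1 (by exact_mod_cast hlt)
  rw [hn0, Int.cast_zero] at hn
  exact sub_eq_zero.1 hn.symm

instance nontrivial_unitAddTorus {d : Type*} [Nonempty d] : Nontrivial (UnitAddTorus d) :=
  have : Nontrivial UnitAddCircle :=
    ⟨_, 0, (AddCircle.coe_eq_zero_iff_of_mem_Ico (p := (1 : ℝ)) ⟨by norm_num, by norm_num⟩).not.2
      (one_half_pos (α := ℝ)).ne'⟩
  Function.nontrivial

theorem toralMap_add (A : Matrix (Fin 2) (Fin 2) ℤ) (x y : UnitAddTorus (Fin 2)) :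
    toralMap A (x + y) = toralMap A x + toralMap A y := by
  ext i
  simp only [toralMap, ContinuousMap.coe_mk, Pi.add_apply, smul_add, Finset.sum_add_distrib]

theorem iterate_toralMap_add (A : Matrix (Fin 2) (Fin 2) ℤ) (n : ℕ) (x y : UnitAddTorus (Fin 2)) :
    (toralMap A)^[n] (x + y) = (toralMap A)^[n] x + (toralMap A)^[n] y :=
  iterate_map_add (AddMonoidHom.mk' (toralMap A) (toralMap_add A)) n x y

/-- The one-parameter subgroup `s ↦ π(s w)` of the torus, a line of direction `w`. -/
def torusLine (w : EuclideanSpace ℝ (Fin 2)) : ℝ →ₜ+ UnitAddTorus (Fin 2) where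
  toFun s := torusProj (s • w)
  map_zero' := by
    ext i
    simp [torusProj]
  map_add' s t := by rw [add_smul, torusProj_add]
  continuous_toFun := by
    unfold torusProj
    fun_prop

theorem torusLine_apply (w : EuclideanSpace ℝ (Fin 2)) (s : ℝ) :
    torusLine w s = torusProj (s • w) :=
  rfl

theorem norm_torusLine_le (w : EuclideanSpace ℝ (Fin 2)) (s : ℝ) :
    ‖torusLine w s‖ ≤ |s| * ‖w‖ :=
  (norm_torusProj_le _).trans_eq (norm_smul s w)

theorem iterate_toralMap_torusLine {A : Matrix (Fin 2) (Fin 2) ℤ} {w : EuclideanSpace ℝ (Fin 2)}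
    {b : ℝ} (hw : planeMap A w = b • w) (n : ℕ) (s : ℝ) :
    (toralMap A)^[n] (torusLine w s) = torusLine w (b ^ n * s) := by
  have hsemiconj : Function.Semiconj (torusLine w) (b * ·) (toralMap A) := fun s => by
    have hs : planeMap A (s • w) = s • planeMap A w := by
      rw [planeMap, WithLp.ofLp_smul, Matrix.mulVec_smul, WithLp.toLp_smul]
      rfl
    rw [torusLine_apply, torusLine_apply, toralMap_torusProj, hs, hw, smul_smul, mul_comm]
  rw [← (hsemiconj.iterate_right n).eq, mul_left_iterate]

theorem denseRange_torusLine {w : EuclideanSpace ℝ (Fin 2)} (hw0 : w 0 ≠ 0)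
    (hw : Irrational (w 1 / w 0)) : DenseRange (torusLine w) := by
  have hrot : DenseRange (· • ((w 1 / w 0 : ℝ) : UnitAddCircle) : ℤ → UnitAddCircle) :=
    AddCircle.denseRange_zsmul_coe_iff.2 (by simpa using hw)
  refine Metric.denseRange_iff.2 fun y ε hε => ?_
  obtain ⟨x, hx⟩ := QuotientAddGroup.mk_surjective (y 0)
  -- the times `(x + k) / w 0`, for `k` an integer, have the right first coordinate, while
  -- their second coordinates run through an orbit of the rotation by the slope
  obtain ⟨k, hk⟩ := Metric.denseRange_iff.1 hrot (y 1 - ((x * (w 1 / w 0) : ℝ) : UnitAddCircle))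
    ε hε
  have hfst : torusLine w ((x + k) / w 0) 0 = y 0 := by
    simp [← hx, torusLine_apply, torusProj, div_mul_cancel₀ _ hw0]
  have hsnd : torusLine w ((x + k) / w 0) 1 =
      k • ((w 1 / w 0 : ℝ) : UnitAddCircle) + ((x * (w 1 / w 0) : ℝ) : UnitAddCircle) := by
    simp only [torusLine_apply, torusProj, PiLp.smul_apply, smul_eq_mul]
    rw [← AddCircle.coe_zsmul, ← AddCircle.coe_add, zsmul_eq_mul]
    congr 1
    ring
  refine ⟨(x + k) / w 0, (dist_pi_lt_iff hε).2 (Fin.forall_fin_two.2 ⟨?_, ?_⟩)⟩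
  · rwa [hfst, dist_self]
  · rwa [hsnd, dist_eq_norm, ← sub_sub, sub_right_comm, ← dist_eq_norm]

theorem exists_isKroneckerFamily_torusLine {K : Type*} [TopologicalSpace K] [CompactSpace K]
    [T2Space K] [TotallyDisconnectedSpace K] [SecondCountableTopology K]
    {A : Matrix (Fin 2) (Fin 2) ℤ} {w : EuclideanSpace ℝ (Fin 2)} {b : ℝ}
    (hw : planeMap A w = b • w) (hb : 1 < |b|) (hdense : DenseRange (torusLine w)) {r : ℝ}
    (hr : 0 < r) :
    ∃ h : C(K, ℝ), (∀ x, |h x| < r) ∧ Function.Injective h ∧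
      IsKroneckerFamily (toralMap A) ((torusLine w : C(ℝ, UnitAddTorus (Fin 2))).comp h) := by
  let F (n : ℕ) : C(ℝ, UnitAddTorus (Fin 2)) :=
    ⟨fun c => torusLine w (b ^ n • c), (map_continuous _).comp (continuous_const_smul _)⟩
  have hF : IsMixingSeq fun n => F n :=
    isMixingSeq_pow_smul (φ := (torusLine w : ℝ →+ UnitAddTorus (Fin 2))) hdense hb
  obtain ⟨h, huniv, hhr⟩ := ((hF.postcomp (K := K)).dense_forall_mapClusterPt fun n =>
    ContinuousMap.continuous_postcomp (F n)).exists_mem_open Metric.isOpen_ball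
      ⟨0, Metric.mem_ball_self hr⟩
  refine ⟨h, fun x => ?_, injective_of_forall_mapClusterPt huniv, fun g => ?_⟩
  · exact (h.norm_coe_le_norm x).trans_lt (mem_ball_zero_iff.1 hhr)
  · convert huniv g with n
    ext1 x
    exact iterate_toralMap_torusLine hw n (h x)

/-- The map `(x, s) ↦ e x + π(s v)`, which thickens the family `e` to segments of half-length `M`
in the direction `v`. -/
def thicken {K : Type*} [TopologicalSpace K] (e : C(K, UnitAddTorus (Fin 2)))
    (v : EuclideanSpace ℝ (Fin 2)) (M : ℝ) : C(K × Icc (-M) M, UnitAddTorus (Fin 2)) where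
  toFun p := e p.1 + torusLine v p.2
  continuous_toFun := by fun_prop

theorem thicken_apply {K : Type*} [TopologicalSpace K] (e : C(K, UnitAddTorus (Fin 2)))
    (v : EuclideanSpace ℝ (Fin 2)) (M : ℝ) (x : K) (s : Icc (-M) M) :
    thicken e v M (x, s) = e x + torusLine v s :=
  rfl

theorem isEmbedding_thicken {K : Type*} [TopologicalSpace K] [CompactSpace K]
    {v w : EuclideanSpace ℝ (Fin 2)} (hvw : LinearIndependent ℝ ![w, v]) {h : C(K, ℝ)}
    (hinj : Function.Injective h) {M : ℝ} (hM : ∀ x, |h x| * ‖w‖ + M * ‖v‖ < 1 / 2) :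
    IsEmbedding (thicken ((torusLine w : C(ℝ, UnitAddTorus (Fin 2))).comp h) v M) := by
  have hproj (x : K) (s : Icc (-M) M) :
      thicken ((torusLine w : C(ℝ, UnitAddTorus (Fin 2))).comp h) v M (x, s) =
        torusProj (h x • w + (s : ℝ) • v) := by
    rw [torusProj_add]
    rfl
  have hball (x : K) (s : Icc (-M) M) :
      h x • w + (s : ℝ) • v ∈ Metric.ball (0 : EuclideanSpace ℝ (Fin 2)) (1 / 2) := by
    rw [mem_ball_zero_iff]
    calc ‖h x • w + (s : ℝ) • v‖ ≤ |h x| * ‖w‖ + |(s : ℝ)| * ‖v‖ := by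
          simpa only [norm_smul, Real.norm_eq_abs] using norm_add_le (h x • w) ((s : ℝ) • v)
      _ ≤ |h x| * ‖w‖ + M * ‖v‖ := by
          gcongr
          exact abs_le.2 s.2
      _ < 1 / 2 := hM x
  refine ((map_continuous _).isClosedEmbedding ?_).isEmbedding
  rintro ⟨x, s⟩ ⟨y, t⟩ hxy
  rw [hproj, hproj] at hxy
  obtain ⟨hx, hs⟩ := hvw.eq_of_pair (injOn_torusProj_ball (hball x s) (hball y t) hxy)
  exact Prod.ext (hinj hx) (Subtype.ext hs)

theorem isEmbedding_of_isEmbedding_thicken {K : Type*} [TopologicalSpace K]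
    {e : C(K, UnitAddTorus (Fin 2))} {v : EuclideanSpace ℝ (Fin 2)} {M : ℝ} (hM : 0 ≤ M)
    (he : IsEmbedding (thicken e v M)) : IsEmbedding e := by
  have hcore := he.comp (isEmbedding_prodMkLeft (⟨0, by simpa, hM⟩ : Icc (-M) M))
  simpa [Function.comp_def, thicken_apply] using hcore

theorem tendsto_dist_iterateAlong_thicken {K : Type*} [TopologicalSpace K] [CompactSpace K]
    {A : Matrix (Fin 2) (Fin 2) ℤ} {v : EuclideanSpace ℝ (Fin 2)} {a : ℝ}
    (hv : planeMap A v = a • v) (ha : |a| < 1) (e : C(K, UnitAddTorus (Fin 2))) (M : ℝ) :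
    Tendsto (fun n => dist (iterateAlong (toralMap A) (thicken e v M) n)
      (iterateAlong (toralMap A) (e.comp ContinuousMap.fst) n)) atTop (𝓝 0) := by
  have hlim : Tendsto (fun n => |a| ^ n * |M| * ‖v‖) atTop (𝓝 0) := by
    simpa using ((tendsto_pow_atTop_nhds_zero_of_lt_one (abs_nonneg a) ha).mul_const |M|).mul_const
      ‖v‖
  refine squeeze_zero (fun n => dist_nonneg) (fun n => ?_) hlim
  refine (ContinuousMap.dist_le (by positivity)).2 fun ⟨x, s⟩ => ?_
  have hiter : iterateAlong (toralMap A) (thicken e v M) n (x, s) =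
      (toralMap A)^[n] (e x) + torusLine v (a ^ n * s) := by
    rw [← iterate_toralMap_torusLine hv, ← iterate_toralMap_add]
    rfl
  have hs : |(s : ℝ)| ≤ |M| := (abs_le.2 s.2).trans (le_abs_self M)
  calc dist (iterateAlong (toralMap A) (thicken e v M) n (x, s)) ((toralMap A)^[n] (e x))
      = ‖torusLine v (a ^ n * s)‖ := by rw [hiter, dist_self_add_left]
    _ ≤ |a ^ n * s| * ‖v‖ := norm_torusLine_le v _
    _ ≤ |a| ^ n * |M| * ‖v‖ := by
      rw [abs_mul, abs_pow]
      gcongr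

theorem theorem4p3_general (A : Matrix (Fin 2) (Fin 2) ℤ) (hdet : A.det ≠ 0) {z : ℂ}
    (hz : z ∈ spectrum ℂ (A.map (Int.cast : ℤ → ℂ))) (hz1 : ‖z‖ < 1) :
    ∃ C : NonemptyCompacts (UnitAddTorus (Fin 2)),
      IsTransitivePoint (inducedMap (toralMap A)) C ∧
      ∃ L : Set (UnitAddTorus (Fin 2)),
        IsCantorSet L ∧
        Nonempty ((C : Set (UnitAddTorus (Fin 2))) ≃ₜ L × Icc (0 : ℝ) 1) ∧
        (∀ x ∈ (C : Set (UnitAddTorus (Fin 2))),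
          Nonempty (connectedComponentIn (C : Set (UnitAddTorus (Fin 2))) x ≃ₜ
            Icc (0 : ℝ) 1)) ∧
        IsKroneckerSet (toralMap A) L ∧
        ∃ (v : EuclideanSpace ℝ (Fin 2)) (μ : ℝ) (M : ℝ),
          ‖v‖ = 1 ∧ planeMap A v = μ • v ∧ |μ| < 1 ∧ 0 < M ∧
          ∃ φ : L × Icc (-M) M ≃ₜ (C : Set (UnitAddTorus (Fin 2))),
            ∀ (a : L) (s : Icc (-M) M),
              ((φ (a, s) : (C : Set (UnitAddTorus (Fin 2)))) : UnitAddTorus (Fin 2)) =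
                (a : UnitAddTorus (Fin 2)) + torusProj ((s : ℝ) • v) := by
  obtain ⟨μ, hμ, b, hb, hμ1, hb1, hirr⟩ := exists_stable_unstable_eigenvalues hdet hz hz1
  obtain ⟨v, hv1, hv⟩ := exists_norm_eq_one_planeMap_eq_smul hμ
  obtain ⟨w, hw1, hw⟩ := exists_norm_eq_one_planeMap_eq_smul hb
  have hv0 : v ≠ 0 := norm_ne_zero_iff.1 (hv1 ▸ one_ne_zero)
  have hw0 : w ≠ 0 := norm_ne_zero_iff.1 (hw1 ▸ one_ne_zero)
  have hwv : LinearIndependent ℝ ![w, v] :=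
    linearIndependent_pair_of_planeMap_eq_smul (by rintro rfl; linarith) hw0 hv0 hw hv
  obtain ⟨hslope0, hslope⟩ := irrational_slope_of_planeMap_eq_smul hirr hw0 hw
  obtain ⟨h, hh, hinj, hkron⟩ := exists_isKroneckerFamily_torusLine (K := ℕ → Bool) hw hb1
    (denseRange_torusLine hslope0 hslope) (r := 1 / 4) (by norm_num)
  have hM : (0 : ℝ) ≤ 1 / 4 := by norm_num
  have : Nonempty (Icc (-(1 / 4) : ℝ) (1 / 4)) := ⟨⟨0, by norm_num⟩⟩
  have : PerfectSpace (ℕ → Bool) := perfectSpace_pi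
  have hΦ := isEmbedding_thicken hwv hinj (M := 1 / 4) fun x => by
    rw [hv1, hw1]
    linarith [hh x]
  have he := isEmbedding_of_isEmbedding_thicken hM hΦ
  have hL := hkron.isKroneckerSet_range he
  have : TotallyDisconnectedSpace (range _) := totallyDisconnectedSpace_subtype_iff.2 hL.1.2.2.2
  have : ConnectedSpace (Icc (0 : ℝ) 1) := Subtype.connectedSpace (isConnected_Icc zero_le_one)
  let φ := rangeProdHomeomorph he hΦ
  let ψ := φ.symm.trans ((Homeomorph.refl _).prodCongr
    (iccHomeoI (-(1 / 4) : ℝ) (1 / 4) (by norm_num)))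
  refine ⟨rangeCompacts _, hkron.isTransitivePoint_rangeCompacts (p := ContinuousMap.fst)
      Prod.fst_surjective (tendsto_dist_iterateAlong_thicken hv hμ1 _ (1 / 4)), _, hL.1, ⟨ψ⟩,
    fun x hx => nonempty_homeomorph_connectedComponentIn ψ hx, hL, v, μ, 1 / 4, hv1, hv, hμ1,
    by norm_num, φ, ?_⟩
  rintro ⟨_, x, rfl⟩ s
  exact rangeProdHomeomorph_apply he hΦ x s

theorem theorem4p3 (A : Matrix (Fin 2) (Fin 2) ℤ) (hA : IsHyperbolicToral A) :
    ∃ C : NonemptyCompacts (UnitAddTorus (Fin 2)),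
      IsTransitivePoint (inducedMap (toralMap A)) C ∧
      ∃ L : Set (UnitAddTorus (Fin 2)),
        IsCantorSet L ∧
        Nonempty ((C : Set (UnitAddTorus (Fin 2))) ≃ₜ L × Icc (0 : ℝ) 1) ∧
        (∀ x ∈ (C : Set (UnitAddTorus (Fin 2))),
          Nonempty (connectedComponentIn (C : Set (UnitAddTorus (Fin 2))) x ≃ₜ
            Icc (0 : ℝ) 1)) ∧
        IsKroneckerSet (toralMap A) L ∧
        ∃ (v : EuclideanSpace ℝ (Fin 2)) (μ : ℝ) (M : ℝ),
          ‖v‖ = 1 ∧ planeMap A v = μ • v ∧ |μ| < 1 ∧ 0 < M ∧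
          ∃ φ : L × Icc (-M) M ≃ₜ (C : Set (UnitAddTorus (Fin 2))),
            ∀ (a : L) (s : Icc (-M) M),
              ((φ (a, s) : (C : Set (UnitAddTorus (Fin 2)))) : UnitAddTorus (Fin 2)) =
                (a : UnitAddTorus (Fin 2)) + torusProj ((s : ℝ) • v) := by
  obtain ⟨z, hz, hz1⟩ := hA.exists_mem_spectrum_norm_lt_one
  exact theorem4p3_general A hA.1.ne_zero hz hz1
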